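/- Let $k\ge 1$ be a fixed integer and let $G_{k,n}$ be the set of $k$-dimensional linear subspaces of Euclidean space $\mathbb{R}^n$, with the chordal distance $d(p,q)=\|\sin\theta\|=\big(\sum_{i=1}^k\sin^2\theta_i\big)^{1/2}$, where $\theta_1,\dots,\theta_k\in[0,\pi/2]$ are the principal angles between $p$ and $q$. For $\delta>0$ let $M(n,\delta)$ be the largest size of a finite subset of $G_{k,n}$ whose distinct elements are at pairwise distance at least $\delta$, and let $$R(\delta)=\limsup_{n\to\infty}\frac1n\ln M(n,\delta).$$ Then for every $0<\delta\le\sqrt k$ $$R(\delta)\le R_{\mathrm R}(\delta):=-k\ln\sqrt{1-\sqrt{1-\frac{\delta^2}{k}}}.$$ Moreover, this is strictly smaller than the Hamming-type bound $R_{\mathrm H}(\delta):=-k\ln\sqrt{1-\sqrt{1-\frac{\delta^2}{2k}}}$: one has $R_{\mathrm R}(\delta)<R_{\mathrm H}(\delta)$ for every $0<\delta\le\sqrt k$. -/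

import Mathlib

open Filter

noncomputable section

/-- `G_{k,n}`: the `k`-dimensional linear subspaces (`k`-planes through the origin) of
Euclidean space `ℝⁿ`. -/
def Gr (k n : ℕ) : Type :=
  {p : Submodule ℝ (EuclideanSpace ℝ (Fin n)) // Module.finrank ℝ p = k}

/-- `x` and `y` are systems of principal vectors of the subspaces `p` and `q`: they are
orthonormal systems of `p` and of `q`, and the pair `(x i, y i)` realizes the smallest angle
between unit vectors `u ∈ p` and `v ∈ q` such that `u` is orthogonal to the previous `x j` and
`v` is orthogonal to the previous `y j`. The principal angles are the angles between `x i`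
and `y i`, here in nondecreasing order. -/
structure IsPrincipalVectors {E : Type*} [NormedAddCommGroup E] [InnerProductSpace ℝ E]
    (p q : Submodule ℝ E) {k : ℕ} (x y : Fin k → E) : Prop where
  mem_left : ∀ i, x i ∈ p
  mem_right : ∀ i, y i ∈ q
  orthonormal_left : Orthonormal ℝ x
  orthonormal_right : Orthonormal ℝ y
  angle_le : ∀ i, ∀ u ∈ p, ∀ v ∈ q, ‖u‖ = 1 → ‖v‖ = 1 →
    (∀ j, j < i → inner ℝ (x j) u = 0) → (∀ j, j < i → inner ℝ (y j) v = 0) →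
    InnerProductGeometry.angle (x i) (y i) ≤ InnerProductGeometry.angle u v

/-- A subspace of dimension larger than `m` has a unit vector orthogonal to `m` given vectors. -/
theorem exists_unit_orthogonal {E : Type*} [NormedAddCommGroup E] [InnerProductSpace ℝ E]
    [FiniteDimensional ℝ E] (p : Submodule ℝ E) {m : ℕ} (hm : m < Module.finrank ℝ p)
    (x : Fin m → E) : ∃ u ∈ p, ‖u‖ = 1 ∧ ∀ j, inner ℝ (x j) u = 0 := by
  let f : p →ₗ[ℝ] (Fin m → ℝ) :=
    LinearMap.pi fun j => (innerₛₗ ℝ (x j)).comp p.subtype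
  have hf : LinearMap.ker f ≠ ⊥ := by
    apply LinearMap.ker_ne_bot_of_finrank_lt
    simpa using hm
  obtain ⟨w, hw, hw0⟩ := Submodule.exists_mem_ne_zero_of_ne_bot hf
  have hw0' : (w : E) ≠ 0 := by simpa using hw0
  refine ⟨(‖(w : E)‖⁻¹ : ℝ) • (w : E), p.smul_mem _ w.2, ?_, fun j => ?_⟩
  · rw [norm_smul, norm_inv, norm_norm, inv_mul_cancel₀ (norm_ne_zero_iff.mpr hw0')]
  · have h : f w j = 0 := by rw [LinearMap.mem_ker.mp hw]; rfl
    have h' : inner ℝ (x j) (w : E) = 0 := h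
    rw [inner_smul_right, h', mul_zero]

/-- Systems of `m` principal vectors exist whenever both subspaces have dimension at least `m`. -/
theorem exists_isPrincipalVectors {E : Type*} [NormedAddCommGroup E] [InnerProductSpace ℝ E]
    [FiniteDimensional ℝ E] (p q : Submodule ℝ E) (m : ℕ) (hp : m ≤ Module.finrank ℝ p)
    (hq : m ≤ Module.finrank ℝ q) :
    ∃ x y : Fin m → E, IsPrincipalVectors p q x y := by
  induction m with
  | zero =>
    exact ⟨Fin.elim0, Fin.elim0, fun i => i.elim0, fun i => i.elim0,
      ⟨fun i => i.elim0, fun i => i.elim0⟩, ⟨fun i => i.elim0, fun i => i.elim0⟩,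
      fun i => i.elim0⟩
  | succ m ih =>
    obtain ⟨x, y, h⟩ := ih (by omega) (by omega)
    have key : ∀ (r : Submodule ℝ E) (z : Fin m → E),
        IsCompact {u : E | u ∈ r ∧ ‖u‖ = 1 ∧ ∀ j, inner ℝ (z j) u = 0} := by
      intro r z
      refine (isCompact_sphere (0 : E) 1).of_isClosed_subset ?_ ?_
      · refine r.closed_of_finiteDimensional.inter ?_
        refine (isClosed_eq continuous_norm continuous_const).inter ?_
        have : {u : E | ∀ j, inner ℝ (z j) u = 0} = ⋂ j, {u : E | inner ℝ (z j) u = 0} := by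
          ext u; simp
        change IsClosed {u : E | ∀ j, inner ℝ (z j) u = 0}
        rw [this]
        exact isClosed_iInter fun j =>
          isClosed_eq (continuous_const.inner continuous_id) continuous_const
      · rintro u ⟨-, hu, -⟩
        simpa using hu
    obtain ⟨u₀, hu₀, hu₁, hu₂⟩ := exists_unit_orthogonal p (by omega) x
    obtain ⟨v₀, hv₀, hv₁, hv₂⟩ := exists_unit_orthogonal q (by omega) y
    obtain ⟨⟨a, b⟩, ⟨⟨ha₀, ha₁, ha₂⟩, hb₀, hb₁, hb₂⟩, hmax⟩ :=
      ((key p x).prod (key q y)).exists_isMaxOn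
        ⟨(u₀, v₀), ⟨hu₀, hu₁, hu₂⟩, hv₀, hv₁, hv₂⟩
        (f := fun w : E × E => inner ℝ w.1 w.2)
        (continuous_fst.inner continuous_snd).continuousOn
    have orth : ∀ (z : Fin m → E) (c : E), Orthonormal ℝ z → ‖c‖ = 1 →
        (∀ j, inner ℝ (z j) c = 0) → Orthonormal ℝ (Fin.snoc z c : Fin (m + 1) → E) := by
      intro z c hz hc hzc
      refine ⟨fun i => ?_, fun i j hij => ?_⟩
      · refine Fin.lastCases ?_ (fun i => ?_) i
        · simpa using hc
        · simpa using hz.1 i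
      · revert hij
        refine Fin.lastCases ?_ (fun i => ?_) i <;> refine Fin.lastCases ?_ (fun j => ?_) j
        · intro hij; exact absurd rfl hij
        · intro _; simpa [real_inner_comm] using hzc j
        · intro _; simpa using hzc i
        · intro hij
          simpa using hz.2 (fun e => hij (congrArg Fin.castSucc e))
    refine ⟨Fin.snoc x a, Fin.snoc y b, fun i => ?_, fun i => ?_, orth x a h.3 ha₁ ha₂,
      orth y b h.4 hb₁ hb₂, fun i => ?_⟩
    · refine Fin.lastCases ?_ (fun i => ?_) i
      · simpa using ha₀
      · simpa using h.1 i
    · refine Fin.lastCases ?_ (fun i => ?_) i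
      · simpa using hb₀
      · simpa using h.2 i
    · refine Fin.lastCases ?_ (fun i => ?_) i
      · intro u hu v hv hu1 hv1 hxu hyv
        have h1 : ∀ j, inner ℝ (x j) u = 0 := fun j => by
          simpa using hxu j.castSucc (Fin.castSucc_lt_last j)
        have h2 : ∀ j, inner ℝ (y j) v = 0 := fun j => by
          simpa using hyv j.castSucc (Fin.castSucc_lt_last j)
        have h3 : inner ℝ u v ≤ inner ℝ a b :=
          hmax (a := (u, v)) ⟨⟨hu, hu1, h1⟩, hv, hv1, h2⟩
        simp only [Fin.snoc_last, InnerProductGeometry.angle, ha₁, hb₁, hu1, hv1, mul_one,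
          div_one]
        exact Real.antitone_arccos h3
      · intro u hu v hv hu1 hv1 hxu hyv
        simp only [Fin.snoc_castSucc]
        refine h.5 i u hu v hv hu1 hv1 (fun j hj => ?_) (fun j hj => ?_)
        · simpa using hxu j.castSucc (Fin.castSucc_lt_castSucc_iff.mpr hj)
        · simpa using hyv j.castSucc (Fin.castSucc_lt_castSucc_iff.mpr hj)

theorem Gr.exists_principal {k n : ℕ} (p q : Gr k n) :
    ∃ w : (Fin k → EuclideanSpace ℝ (Fin n)) × (Fin k → EuclideanSpace ℝ (Fin n)),
      IsPrincipalVectors p.1 q.1 w.1 w.2 := by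
  obtain ⟨x, y, h⟩ := exists_isPrincipalVectors p.1 q.1 k p.2.ge q.2.ge
  exact ⟨(x, y), h⟩

/-- The `k` principal angles between two `k`-planes. They do not depend on the system of
principal vectors that is chosen. -/
def principalAngle {k n : ℕ} (p q : Gr k n) (i : Fin k) : ℝ :=
  InnerProductGeometry.angle ((Gr.exists_principal p q).choose.1 i)
    ((Gr.exists_principal p q).choose.2 i)

/-- The chordal distance `d(p, q) = ‖(sin θ₁, …, sin θ_k)‖` (Euclidean norm). -/
def chordalDist {k n : ℕ} (p q : Gr k n) : ℝ :=
  ‖(WithLp.toLp 2 (fun i => Real.sin (principalAngle p q i)) : EuclideanSpace ℝ (Fin k))‖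

/-- A code of distance `δ`: a finite collection of planes with pairwise chordal distances
at least `δ`. -/
def IsCode {k n : ℕ} (δ : ℝ) (C : Finset (Gr k n)) : Prop :=
  (C : Set (Gr k n)).Pairwise fun p q => δ ≤ chordalDist p q

/-- The supremum in `ℕ ∪ {∞}` of the sizes `M` of the codes of distance `δ` in `G_{k,n}`. -/
def maxCodeSize (k n : ℕ) (δ : ℝ) : ℕ∞ :=
  ⨆ (C : Finset (Gr k n)) (_ : IsCode δ C), (C.card : ℕ∞)

/-- The asymptotic rate `R(δ) = limsup_{n → ∞} (1/n) ln M`, as an extended real number. -/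
def rate (k : ℕ) (δ : ℝ) : EReal :=
  limsup (fun n : ℕ => ENNReal.log (maxCodeSize k n δ : ENNReal) / (n : EReal)) atTop

/-- The bound `R_R(δ) = -k ln √(1 - √(1 - δ²/k))`. -/
def rankinBound (k : ℕ) (δ : ℝ) : ℝ :=
  -(k : ℝ) * Real.log (Real.sqrt (1 - Real.sqrt (1 - δ ^ 2 / (k : ℝ))))

/-- The Hamming-type bound `R_H(δ) = -k ln √(1 - √(1 - δ²/(2k)))`. -/
def hammingBound (k : ℕ) (δ : ℝ) : ℝ :=
  -(k : ℝ) * Real.log (Real.sqrt (1 - Real.sqrt (1 - δ ^ 2 / (2 * (k : ℝ)))))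

end

noncomputable section

open MeasureTheory Topology

/-! This is Blichfeldt's density argument, run in the space of `k`-tuples of vectors of `ℝⁿ`. A
plane `p` with orthonormal frame `u` gets the neighbourhood `frameNhd` of tuples `v = t • u + w`,
where the components of `w` lie in the ball of radius `ρ = √(1 - t²)` and are almost orthogonal to
each other and to `u`. In high dimension almost orthogonality costs at most half of the volume of
the product of balls (`volume_pi_closedBall_le`), and it forces `‖v j‖² ≤ 1 + 2ε`. So all
neighbourhoods lie in a product of balls of radius about 1, whose volume exceeds that of each
neighbourhood by a factor of at most about `2 ρ^(-nk)`.

The neighbourhoods may overlap, but only boundedly often. Identify `p` with its orthogonal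
projection; in the Hilbert-Schmidt inner product two planes satisfy `⟨p, q⟩ = k - d(p, q)²`
(`sum_inner_frame_sq`). If `v` lies in the neighbourhoods of `N` code planes, the form `∑ v j ⊗ v j`
has squared norm about `k` and inner product at least about `k t²` with each projection.
Cauchy-Schwarz against the sum of the projections (`IsCode.card_mul_le`) gives `N² k² t⁴ ≲ k (N k +
N² (k - δ²))`, which bounds `N` independently of `n` once `t⁴ > 1 - δ²/k`.

Hence the rate is at most `-k ln ρ`, up to an error vanishing with `ε`, and `t² → √(1 - δ²/k)` gives
the Rankin bound. -/

/-! ### Principal vectors and the trace formula for the chordal distance -/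

theorem IsPrincipalVectors.inner_le {E : Type*} [NormedAddCommGroup E] [InnerProductSpace ℝ E]
    {p q : Submodule ℝ E} {k : ℕ} {x y : Fin k → E} (h : IsPrincipalVectors p q x y) (i : Fin k)
    {u v : E} (hu : u ∈ p) (hv : v ∈ q) (hu1 : ‖u‖ = 1) (hv1 : ‖v‖ = 1)
    (hxu : ∀ j, j < i → inner ℝ (x j) u = 0) (hyv : ∀ j, j < i → inner ℝ (y j) v = 0) :
    inner ℝ u v ≤ inner ℝ (x i) (y i) := by
  have h1 := Real.cos_le_cos_of_nonneg_of_le_pi (InnerProductGeometry.angle_nonneg _ _)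
    (InnerProductGeometry.angle_le_pi _ _) (h.angle_le i u hu v hv hu1 hv1 hxu hyv)
  simpa [InnerProductGeometry.cos_angle, hu1, hv1, h.orthonormal_left.1 i,
    h.orthonormal_right.1 i] using h1

theorem IsPrincipalVectors.symm {E : Type*} [NormedAddCommGroup E] [InnerProductSpace ℝ E]
    {p q : Submodule ℝ E} {k : ℕ} {x y : Fin k → E} (h : IsPrincipalVectors p q x y) :
    IsPrincipalVectors q p y x where
  mem_left := h.mem_right
  mem_right := h.mem_left
  orthonormal_left := h.orthonormal_right
  orthonormal_right := h.orthonormal_left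
  angle_le i u hu v hv hu1 hv1 hxu hyv := by
    rw [InnerProductGeometry.angle_comm, InnerProductGeometry.angle_comm u v]
    exact h.angle_le i v hv u hu hv1 hu1 hyv hxu

/-- Otherwise the normalized projection of `x i` to the span of `y i` and `y j` would have inner
product `√(a² + b²) > a` with `x i`. It is still admissible at stage `i`, because `y i` and `y j`
are both orthogonal to the earlier `y l`; this contradicts the minimality of the angle. -/
theorem IsPrincipalVectors.inner_eq_zero_of_lt {E : Type*} [NormedAddCommGroup E]
    [InnerProductSpace ℝ E] {p q : Submodule ℝ E} {k : ℕ} {x y : Fin k → E}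
    (h : IsPrincipalVectors p q x y) {i j : Fin k} (hij : i < j) :
    inner ℝ (x i) (y j) = 0 := by
  set a : ℝ := inner ℝ (x i) (y i) with ha
  set b : ℝ := inner ℝ (x i) (y j) with hb
  by_contra hb0
  set s : ℝ := Real.sqrt (a ^ 2 + b ^ 2) with hs
  have hpos : 0 < a ^ 2 + b ^ 2 := by positivity
  have hs0 : 0 < s := Real.sqrt_pos.mpr hpos
  have hs2 : s ^ 2 = a ^ 2 + b ^ 2 := Real.sq_sqrt hpos.le
  have hyij : inner ℝ (y i) (y j) = 0 := h.orthonormal_right.2 hij.ne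
  have hn : ‖a • y i + b • y j‖ = s := by
    rw [hs, ← Real.sqrt_sq (norm_nonneg _)]
    congr 1
    rw [norm_add_sq_real, norm_smul, norm_smul, inner_smul_left, inner_smul_right, hyij,
      h.orthonormal_right.1, h.orthonormal_right.1]
    simp
  have key := h.inner_le i (h.mem_left i)
    (q.smul_mem s⁻¹ (q.add_mem (q.smul_mem a (h.mem_right i)) (q.smul_mem b (h.mem_right j))))
    (h.orthonormal_left.1 i) (by rw [norm_smul, hn, norm_inv, Real.norm_of_nonneg hs0.le,
      inv_mul_cancel₀ hs0.ne'])
    (fun l hl => h.orthonormal_left.2 hl.ne)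
    (fun l hl => by
      rw [inner_smul_right, inner_add_right, inner_smul_right, inner_smul_right,
        h.orthonormal_right.2 hl.ne, h.orthonormal_right.2 (hl.trans hij).ne]
      simp)
  rw [inner_smul_right, inner_add_right, inner_smul_right, inner_smul_right, ← ha, ← hb] at key
  have h2 : s⁻¹ * (a * a + b * b) = s := by
    rw [show a * a + b * b = s * s by rw [← sq s, hs2]; ring, inv_mul_cancel_left₀ hs0.ne']
  rw [h2] at key
  have : 0 < b ^ 2 := by positivity
  nlinarith

theorem IsPrincipalVectors.inner_eq_zero {E : Type*} [NormedAddCommGroup E]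
    [InnerProductSpace ℝ E] {p q : Submodule ℝ E} {k : ℕ} {x y : Fin k → E}
    (h : IsPrincipalVectors p q x y) {i j : Fin k} (hij : i ≠ j) :
    inner ℝ (x i) (y j) = 0 := by
  rcases lt_or_gt_of_ne hij with h1 | h1
  · exact h.inner_eq_zero_of_lt h1
  · rw [real_inner_comm]
    exact h.symm.inner_eq_zero_of_lt h1

/-- For an orthonormal system spanning `p`, the sum of the squared coefficients of `z` is the
squared norm of the projection of `z` to `p`. -/
theorem sum_inner_sq_eq_norm_orthogonalProjectionOnto {E : Type*} [NormedAddCommGroup E]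
    [InnerProductSpace ℝ E] [FiniteDimensional ℝ E] {p : Submodule ℝ E} {k : ℕ}
    (hp : Module.finrank ℝ p = k) {x : Fin k → E} (hx : Orthonormal ℝ x) (hxp : ∀ i, x i ∈ p)
    (z : E) : ∑ i, (inner ℝ (x i) z) ^ 2 = ‖p.orthogonalProjectionOnto z‖ ^ 2 := by
  let x' : Fin k → p := fun i => ⟨x i, hxp i⟩
  have hx' : Orthonormal ℝ x' := by
    refine ⟨fun i => hx.1 i, fun i j hij => hx.2 hij⟩
  have hsp : ⊤ ≤ Submodule.span ℝ (Set.range x') := by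
    rw [top_le_iff]
    apply hx'.linearIndependent.span_eq_top_of_card_eq_finrank'
    simp [hp]
  have h := (OrthonormalBasis.mk hx' hsp).sum_sq_norm_inner_right (p.orthogonalProjectionOnto z)
  rw [← h]
  refine Finset.sum_congr rfl fun i _ => ?_
  simp only [OrthonormalBasis.coe_mk, Real.norm_eq_abs, sq_abs]
  congr 1
  exact (Submodule.inner_orthogonalProjectionOnto_eq_of_mem_left (x' i) z).symm

/-- An orthonormal basis of a `k`-plane. -/
theorem Gr.exists_orthonormal {k n : ℕ} (p : Gr k n) :
    ∃ u : Fin k → EuclideanSpace ℝ (Fin n), Orthonormal ℝ u ∧ ∀ i, u i ∈ p.1 := by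
  obtain ⟨w, h⟩ := Gr.exists_principal p p
  exact ⟨w.1, h.orthonormal_left, h.mem_left⟩

/-- A choice of an orthonormal basis of each `k`-plane. -/
def Gr.frame {k n : ℕ} (p : Gr k n) : Fin k → EuclideanSpace ℝ (Fin n) :=
  p.exists_orthonormal.choose

theorem Gr.orthonormal_frame {k n : ℕ} (p : Gr k n) : Orthonormal ℝ p.frame :=
  p.exists_orthonormal.choose_spec.1

theorem Gr.frame_mem {k n : ℕ} (p : Gr k n) (i : Fin k) : p.frame i ∈ p.1 :=
  p.exists_orthonormal.choose_spec.2 i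

/-- The trace of the product of the projections to `p` and `q` is `k - d(p, q)²`. -/
theorem sum_inner_frame_sq {k n : ℕ} (p q : Gr k n) :
    ∑ i, ∑ j, (inner ℝ (p.frame i) (q.frame j)) ^ 2 = k - chordalDist p q ^ 2 := by
  obtain h := (Gr.exists_principal p q).choose_spec
  set x := (Gr.exists_principal p q).choose.1 with hx
  set y := (Gr.exists_principal p q).choose.2 with hy
  -- The double sum does not depend on the orthonormal bases; they are exchanged for the principal
  -- vectors one plane at a time.
  have h1 : ∑ i, ∑ j, (inner ℝ (p.frame i) (q.frame j)) ^ 2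
      = ∑ i, ∑ j, (inner ℝ (x i) (y j)) ^ 2 := by
    calc _ = ∑ i, ∑ j, (inner ℝ (p.frame i) (y j)) ^ 2 := by
          refine Finset.sum_congr rfl fun i _ => ?_
          simp_rw [real_inner_comm _ (p.frame i)]
          rw [sum_inner_sq_eq_norm_orthogonalProjectionOnto q.2 q.orthonormal_frame q.frame_mem,
            sum_inner_sq_eq_norm_orthogonalProjectionOnto q.2 h.orthonormal_right h.mem_right]
      _ = _ := by
          rw [Finset.sum_comm, Finset.sum_comm (f := fun i j => (inner ℝ (x i) (y j)) ^ 2)]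
          refine Finset.sum_congr rfl fun i _ => ?_
          rw [sum_inner_sq_eq_norm_orthogonalProjectionOnto p.2 p.orthonormal_frame p.frame_mem,
            sum_inner_sq_eq_norm_orthogonalProjectionOnto p.2 h.orthonormal_left h.mem_left]
  rw [h1, chordalDist, EuclideanSpace.norm_sq_eq]
  -- Only the diagonal term survives, and it equals `cos² θ_i`.
  have h2 : ∀ i, ∑ j, (inner ℝ (x i) (y j)) ^ 2
      = 1 - ‖(Real.sin (principalAngle p q i))‖ ^ 2 := fun i => by
    rw [Finset.sum_eq_single i (fun j _ hj => by rw [h.inner_eq_zero hj.symm]; simp) (by simp)]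
    have : Real.cos (principalAngle p q i) = inner ℝ (x i) (y i) := by
      rw [principalAngle, InnerProductGeometry.cos_angle, ← hx, ← hy, h.orthonormal_left.1,
        h.orthonormal_right.1]
      simp
    rw [← this, Real.norm_eq_abs, sq_abs, Real.cos_sq']
  simp [h2]

/-! ### Cauchy-Schwarz bound for codes -/

/-- The tensor square `x ⊗ x`. -/
def tensorSq {n : ℕ} (x : EuclideanSpace ℝ (Fin n)) : EuclideanSpace ℝ (Fin n × Fin n) :=
  WithLp.toLp 2 fun a => x a.1 * x a.2

/-- Through this identity `∑ j, tensorSq (p.frame j)` plays the role of the projection to `p`, with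
the trace form as inner product. -/
theorem inner_tensorSq {n : ℕ} (x y : EuclideanSpace ℝ (Fin n)) :
    inner ℝ (tensorSq x) (tensorSq y) = (inner ℝ x y) ^ 2 := by
  simp only [PiLp.inner_apply, tensorSq, Fintype.sum_prod_type, sq, Finset.sum_mul_sum]
  refine Finset.sum_congr rfl fun a _ => Finset.sum_congr rfl fun b _ => ?_
  simp
  ring

/-- Cauchy-Schwarz for the sum of the projections to the planes of a code and the quadratic form
of a system of vectors. -/
theorem IsCode.card_mul_le {k n : ℕ} {δ : ℝ} (hδ : 0 ≤ δ) {C : Finset (Gr k n)} (hC : IsCode δ C)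
    (v : Fin k → EuclideanSpace ℝ (Fin n)) {c A : ℝ} (hc : 0 ≤ c)
    (hv : ∀ p ∈ C, c ≤ ∑ j, (inner ℝ (p.frame j) (v j)) ^ 2)
    (hA : ∑ i, ∑ j, (inner ℝ (v i) (v j)) ^ 2 ≤ A) (hδk : δ ^ 2 ≤ k) :
    (C.card : ℝ) * (c ^ 2 - A * (k - δ ^ 2)) ≤ A * k := by
  classical
  set a := ∑ j, tensorSq (v j) with ha
  set b := ∑ p ∈ C, ∑ j, tensorSq (p.frame j) with hb
  have hA0 : 0 ≤ A := le_trans (by positivity) hA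
  have haa : ‖a‖ ^ 2 ≤ A := by
    rw [← real_inner_self_eq_norm_sq, ha, sum_inner]
    simpa only [inner_sum, inner_tensorSq] using hA
  have hbb : ‖b‖ ^ 2 ≤ C.card * k + (C.card : ℝ) ^ 2 * (k - δ ^ 2) := by
    have h1 : ∀ p ∈ C, ∀ q ∈ C, ∑ i, ∑ j, (inner ℝ (p.frame i) (q.frame j)) ^ 2
        ≤ (if p = q then (k : ℝ) else 0) + (k - δ ^ 2) := by
      intro p hp q hq
      rw [sum_inner_frame_sq]
      split_ifs with hpq
      · nlinarith [sq_nonneg (chordalDist p q)]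
      · have h3 : δ ≤ chordalDist p q := hC hp hq hpq
        have := pow_le_pow_left₀ hδ h3 2
        linarith
    calc ‖b‖ ^ 2 = ∑ p ∈ C, ∑ q ∈ C, ∑ i, ∑ j, (inner ℝ (p.frame i) (q.frame j)) ^ 2 := by
          rw [← real_inner_self_eq_norm_sq, hb, sum_inner]
          refine Finset.sum_congr rfl fun p _ => ?_
          rw [inner_sum]
          refine Finset.sum_congr rfl fun q _ => ?_
          simp only [sum_inner, inner_sum, inner_tensorSq]
          exact Finset.sum_comm
      _ ≤ ∑ p ∈ C, ∑ q ∈ C, ((if p = q then (k : ℝ) else 0) + (k - δ ^ 2)) :=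
          Finset.sum_le_sum fun p hp => Finset.sum_le_sum fun q hq => h1 p hp q hq
      _ = _ := by
          simp only [Finset.sum_add_distrib, Finset.sum_ite_eq, Finset.sum_const, nsmul_eq_mul]
          rw [← Finset.sum_filter]
          simp
          ring
  -- The hypothesis `hv` controls only the matched terms `i = j`; the remaining squares are
  -- nonnegative and are dropped.
  have hab : C.card * c ≤ inner ℝ b a := by
    rw [hb, ha, sum_inner, ← nsmul_eq_mul]
    refine Finset.card_nsmul_le_sum _ _ _ fun p hp => (hv p hp).trans ?_
    simp only [sum_inner, inner_sum, inner_tensorSq]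
    exact Finset.sum_le_sum fun j _ => Finset.single_le_sum
      (f := fun i => (inner ℝ (p.frame i) (v j)) ^ 2) (fun _ _ => sq_nonneg _) (Finset.mem_univ j)
  have hcs : (C.card * c) ^ 2
      ≤ (C.card * k + (C.card : ℝ) ^ 2 * (k - δ ^ 2)) * A := by
    calc (C.card * c) ^ 2 ≤ (‖b‖ * ‖a‖) ^ 2 :=
          pow_le_pow_left₀ (by positivity) (hab.trans (real_inner_le_norm _ _)) 2
      _ = ‖b‖ ^ 2 * ‖a‖ ^ 2 := by ring
      _ ≤ _ := by
        refine mul_le_mul hbb haa (by positivity) (le_trans (by positivity) hbb)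
  rcases Nat.eq_zero_or_pos C.card with h0 | h0
  · rw [h0]; simpa using by positivity
  · have h0' : (0 : ℝ) < C.card := by exact_mod_cast h0
    refine le_of_mul_le_mul_left ?_ h0'
    nlinarith

/-! ### Almost orthogonality in high-dimensional balls -/

/-- The uniform distribution on the ball of radius `ρ` around the origin. -/
def ballUniform (n : ℕ) (ρ : ℝ) : Measure (EuclideanSpace ℝ (Fin n)) :=
  (volume (Metric.closedBall (0 : EuclideanSpace ℝ (Fin n)) ρ))⁻¹ •
    volume.restrict (Metric.closedBall 0 ρ)

theorem volume_closedBall_pos (n : ℕ) {ρ : ℝ} (hρ : 0 < ρ) :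
    volume (Metric.closedBall (0 : EuclideanSpace ℝ (Fin n)) ρ) ≠ 0 :=
  (Metric.measure_closedBall_pos volume _ hρ).ne'

theorem volume_closedBall_ne_top (n : ℕ) (ρ : ℝ) :
    volume (Metric.closedBall (0 : EuclideanSpace ℝ (Fin n)) ρ) ≠ ⊤ :=
  measure_closedBall_lt_top.ne

theorem isProbabilityMeasure_ballUniform (n : ℕ) {ρ : ℝ} (hρ : 0 < ρ) :
    IsProbabilityMeasure (ballUniform n ρ) := by
  refine ⟨?_⟩
  rw [ballUniform, Measure.smul_apply, Measure.restrict_apply_univ, smul_eq_mul]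
  exact ENNReal.inv_mul_cancel (volume_closedBall_pos n hρ) (volume_closedBall_ne_top n ρ)

theorem lintegral_ballUniform_comp (n : ℕ) (ρ : ℝ)
    (f : EuclideanSpace ℝ (Fin n) ≃ₗᵢ[ℝ] EuclideanSpace ℝ (Fin n))
    {g : EuclideanSpace ℝ (Fin n) → ENNReal} (hg : Measurable g) :
    ∫⁻ x, g (f x) ∂ballUniform n ρ = ∫⁻ x, g x ∂ballUniform n ρ := by
  have h := f.measurePreserving.restrict_preimage
    (Metric.isClosed_closedBall (x := (0 : EuclideanSpace ℝ (Fin n))) (ε := ρ)).measurableSet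
  have h2 : f ⁻¹' Metric.closedBall 0 ρ = Metric.closedBall 0 ρ := by
    ext x; simp
  rw [h2] at h
  rw [ballUniform, lintegral_smul_measure, lintegral_smul_measure, h.lintegral_comp hg]

theorem measurable_ofReal_inner_sq {n : ℕ} (u : EuclideanSpace ℝ (Fin n)) :
    Measurable fun x : EuclideanSpace ℝ (Fin n) => ENNReal.ofReal ((inner ℝ x u) ^ 2) :=
  ENNReal.measurable_ofReal.comp (by fun_prop)

/-- The reflection in the hyperplane orthogonal to `u - v` carries `u` to `v` and preserves the
ball. -/
theorem lintegral_inner_sq_eq_of_norm_eq (n : ℕ) (ρ : ℝ) {u v : EuclideanSpace ℝ (Fin n)}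
    (huv : ‖u‖ = ‖v‖) :
    ∫⁻ x, ENNReal.ofReal ((inner ℝ x u) ^ 2) ∂ballUniform n ρ
      = ∫⁻ x, ENNReal.ofReal ((inner ℝ x v) ^ 2) ∂ballUniform n ρ := by
  set f := (ℝ ∙ (u - v))ᗮ.reflection with hf
  have hfu : f u = v := Submodule.reflection_sub huv
  rw [← lintegral_ballUniform_comp n ρ f (measurable_ofReal_inner_sq v), ← hfu]
  simp

/-- Chebyshev's inequality for a linear functional on a ball. -/
theorem ballUniform_le_abs_inner {n : ℕ} (hn : 0 < n) {ρ : ℝ} (hρ : 0 < ρ) (hρ1 : ρ ≤ 1)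
    {u : EuclideanSpace ℝ (Fin n)} (hu : ‖u‖ ≤ 1) {ε : ℝ} (hε : 0 < ε) :
    ballUniform n ρ {x | ε ≤ |inner ℝ x u|} ≤ ENNReal.ofReal (1 / (n * ε ^ 2)) := by
  have := isProbabilityMeasure_ballUniform n hρ
  set I := ∫⁻ x, ENNReal.ofReal ((inner ℝ x u) ^ 2) ∂ballUniform n ρ with hI
  have hae : ∀ᵐ x ∂ballUniform n ρ, ‖x‖ ≤ ρ := by
    refine Measure.ae_smul_measure ?_ _
    filter_upwards [ae_restrict_mem Metric.isClosed_closedBall.measurableSet] with x hx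
    simpa using hx
  -- By rotation invariance `I` is also the second moment along each basis vector scaled to length
  -- `‖u‖`; over all `n` of them the squares add up to `‖u‖² ‖x‖² ≤ 1`.
  have h1 : (n : ENNReal) * I ≤ 1 := by
    calc (n : ENNReal) * I
        = ∑ a : Fin n, ∫⁻ x, ENNReal.ofReal
            ((inner ℝ x (‖u‖ • EuclideanSpace.basisFun (Fin n) ℝ a)) ^ 2) ∂ballUniform n ρ := by
          have : ∀ a : Fin n, ∫⁻ x, ENNReal.ofReal
            ((inner ℝ x (‖u‖ • EuclideanSpace.basisFun (Fin n) ℝ a)) ^ 2) ∂ballUniform n ρ = I :=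
            fun a => lintegral_inner_sq_eq_of_norm_eq n ρ (by simp [norm_smul])
          rw [Finset.sum_congr rfl fun a _ => this a]
          simp
      _ = ∫⁻ x, ∑ a : Fin n, ENNReal.ofReal
            ((inner ℝ x (‖u‖ • EuclideanSpace.basisFun (Fin n) ℝ a)) ^ 2) ∂ballUniform n ρ :=
          (lintegral_finsetSum _ fun a _ => measurable_ofReal_inner_sq _).symm
      _ ≤ ∫⁻ x, 1 ∂ballUniform n ρ := by
          refine lintegral_mono_ae ?_
          filter_upwards [hae] with x hx
          rw [← ENNReal.ofReal_sum_of_nonneg fun _ _ => sq_nonneg _, ENNReal.ofReal_le_one]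
          have h2 := (EuclideanSpace.basisFun (Fin n) ℝ).sum_sq_norm_inner_left x
          simp only [Real.norm_eq_abs, sq_abs] at h2
          simp only [inner_smul_right, mul_pow, ← Finset.mul_sum]
          rw [h2]
          have := norm_nonneg x
          have := norm_nonneg u
          rw [← mul_pow]
          exact pow_le_one₀ (by positivity) (mul_le_one₀ hu (norm_nonneg x) (hx.trans hρ1))
      _ = 1 := by simp
  have hn' : (n : ENNReal) ≠ 0 := by exact_mod_cast hn.ne'
  have h2 : I ≤ (n : ENNReal)⁻¹ := by
    rw [← one_div, ENNReal.le_div_iff_mul_le (Or.inl hn') (Or.inl (ENNReal.natCast_ne_top n)),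
      mul_comm]
    exact h1
  have hε2 : 0 < ε ^ 2 := by positivity
  calc ballUniform n ρ {x | ε ≤ |inner ℝ x u|}
      ≤ ballUniform n ρ {x | ENNReal.ofReal (ε ^ 2) ≤ ENNReal.ofReal ((inner ℝ x u) ^ 2)} := by
        refine measure_mono fun x hx => ENNReal.ofReal_le_ofReal ?_
        rw [← sq_abs (inner ℝ x u)]
        exact pow_le_pow_left₀ hε.le hx 2
    _ ≤ I / ENNReal.ofReal (ε ^ 2) :=
        meas_ge_le_lintegral_div (measurable_ofReal_inner_sq u).aemeasurable (by simpa using hε.ne')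
          ENNReal.ofReal_ne_top
    _ ≤ (n : ENNReal)⁻¹ / ENNReal.ofReal (ε ^ 2) := by gcongr
    _ = ENNReal.ofReal (1 / (n * ε ^ 2)) := by
        rw [one_div, mul_inv, ENNReal.ofReal_mul (by positivity),
          ENNReal.ofReal_inv_of_pos (by exact_mod_cast hn), ENNReal.ofReal_inv_of_pos hε2,
          ENNReal.ofReal_natCast, div_eq_mul_inv]

/-- Systems of `k` vectors that are almost orthogonal to each other and to the vectors `u l`. -/
def almostOrthogonal {k n : ℕ} (u : Fin k → EuclideanSpace ℝ (Fin n)) (ε : ℝ) :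
    Set (Fin k → EuclideanSpace ℝ (Fin n)) :=
  {w | (∀ j l, |inner ℝ (w j) (u l)| < ε) ∧ ∀ i j, i ≠ j → |inner ℝ (w i) (w j)| < ε}

theorem isOpen_almostOrthogonal {k n : ℕ} (u : Fin k → EuclideanSpace ℝ (Fin n)) (ε : ℝ) :
    IsOpen (almostOrthogonal u ε) := by
  have : almostOrthogonal u ε = (⋂ j, ⋂ l, {w | |inner ℝ (w j) (u l)| < ε}) ∩
      ⋂ i, ⋂ j, ⋂ _ : i ≠ j, {w | |inner ℝ (w i) (w j)| < ε} := by
    ext w; simp [almostOrthogonal]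
  rw [this]
  refine (isOpen_iInter_of_finite fun j => isOpen_iInter_of_finite fun l => ?_).inter
    (isOpen_iInter_of_finite fun i => isOpen_iInter_of_finite fun j =>
      isOpen_iInter_of_finite fun _ => ?_)
  · exact isOpen_lt (by fun_prop) continuous_const
  · exact isOpen_lt (by fun_prop) continuous_const

/-- The components are independent: with `w i` fixed, a vector of norm at most `ρ ≤ 1`, Chebyshev's
inequality applies to `w j`. -/
theorem pi_ballUniform_le_abs_inner {k n : ℕ} (hn : 0 < n) {ρ : ℝ} (hρ : 0 < ρ) (hρ1 : ρ ≤ 1)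
    {ε : ℝ} (hε : 0 < ε) {i j : Fin k} (hij : i ≠ j) :
    Measure.pi (fun _ : Fin k => ballUniform n ρ) {w | ε ≤ |inner ℝ (w i) (w j)|}
      ≤ ENNReal.ofReal (1 / (n * ε ^ 2)) := by
  have := isProbabilityMeasure_ballUniform n hρ
  set μ := ballUniform n ρ with hμ
  have hind := (ProbabilityTheory.iIndepFun_pi (μ := fun _ : Fin k => μ)
    (X := fun _ => id) (fun _ => aemeasurable_id)).indepFun hij
  have hmap := hind.map_prod_eq_prod_map_map (measurable_pi_apply i).aemeasurable
    (measurable_pi_apply j).aemeasurable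
  have heval (l : Fin k) : (Measure.pi fun _ : Fin k => μ).map (fun w => w l) = μ :=
    (measurePreserving_eval (fun _ : Fin k => μ) l).map_eq
  simp only [heval] at hmap
  have hS : MeasurableSet {x : EuclideanSpace ℝ (Fin n) × EuclideanSpace ℝ (Fin n) |
      ε ≤ |inner ℝ x.1 x.2|} :=
    (isClosed_le continuous_const (by fun_prop)).measurableSet
  have hae : ∀ᵐ x ∂μ, ‖x‖ ≤ ρ := by
    refine Measure.ae_smul_measure ?_ _
    filter_upwards [ae_restrict_mem Metric.isClosed_closedBall.measurableSet] with x hx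
    simpa using hx
  calc Measure.pi (fun _ : Fin k => μ) {w | ε ≤ |inner ℝ (w i) (w j)|}
      = (μ.prod μ) {x | ε ≤ |inner ℝ x.1 x.2|} := by
        rw [← hmap, Measure.map_apply (by fun_prop) hS]
        rfl
    _ = ∫⁻ x, μ (Prod.mk x ⁻¹' {x | ε ≤ |inner ℝ x.1 x.2|}) ∂μ := Measure.prod_apply hS
    _ ≤ ∫⁻ x, ENNReal.ofReal (1 / (n * ε ^ 2)) ∂μ := by
        refine lintegral_mono_ae ?_
        filter_upwards [hae] with x hx
        have := ballUniform_le_abs_inner hn hρ hρ1 (hx.trans hρ1) hε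
        simpa only [Set.preimage_ofPred_eq, real_inner_comm x] using this
    _ = _ := by simp

/-- Union bound over at most `2k²` bad events, each of probability at most `1 / (n ε²)`; the
constant 4 in `hn` makes the total at most `1/2`. -/
theorem half_le_pi_ballUniform_almostOrthogonal {k n : ℕ} {ρ : ℝ} (hρ : 0 < ρ) (hρ1 : ρ ≤ 1)
    {ε : ℝ} (hε : 0 < ε) (hn0 : 0 < n) (hn : 4 * (k : ℝ) ^ 2 ≤ n * ε ^ 2)
    (u : Fin k → EuclideanSpace ℝ (Fin n)) (hu : ∀ l, ‖u l‖ ≤ 1) :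
    2⁻¹ ≤ Measure.pi (fun _ : Fin k => ballUniform n ρ) (almostOrthogonal u ε) := by
  have := isProbabilityMeasure_ballUniform n hρ
  set P := Measure.pi (fun _ : Fin k => ballUniform n ρ) with hP
  set c := ENNReal.ofReal (1 / (n * ε ^ 2)) with hc
  have hsub : (almostOrthogonal u ε)ᶜ ⊆ (⋃ j, ⋃ l, {w | ε ≤ |inner ℝ (w j) (u l)|}) ∪
      ⋃ i, ⋃ j, {w | i ≠ j ∧ ε ≤ |inner ℝ (w i) (w j)|} := by
    intro w hw
    simp only [almostOrthogonal, Set.mem_compl_iff, Set.mem_ofPred_eq, not_and_or, not_forall,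
      not_lt] at hw
    rcases hw with ⟨j, l, h⟩ | ⟨i, j, hij, h⟩
    · left; simp only [Set.mem_iUnion]; exact ⟨j, l, h⟩
    · right; simp only [Set.mem_iUnion]; exact ⟨i, j, hij, h⟩
  have hA : ∀ j l, P {w | ε ≤ |inner ℝ (w j) (u l)|} ≤ c := fun j l => by
    have h1 := ballUniform_le_abs_inner hn0 hρ hρ1 (hu l) hε
    rwa [← (measurePreserving_eval (fun _ : Fin k => ballUniform n ρ) j).measure_preimage
      (isClosed_le continuous_const (by fun_prop)).measurableSet.nullMeasurableSet] at h1
  have hB : ∀ i j : Fin k, P {w | i ≠ j ∧ ε ≤ |inner ℝ (w i) (w j)|} ≤ c := fun i j => by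
    by_cases hij : i = j
    · simp [hij]
    · exact (measure_mono fun w hw => hw.2).trans (pi_ballUniform_le_abs_inner hn0 hρ hρ1 hε hij)
  have hcompl : P (almostOrthogonal u ε)ᶜ ≤ 2⁻¹ := by
    calc P (almostOrthogonal u ε)ᶜ
        ≤ (∑ j : Fin k, ∑ l : Fin k, c) + ∑ i : Fin k, ∑ j : Fin k, c := by
          refine (measure_mono hsub).trans ((measure_union_le _ _).trans ?_)
          refine add_le_add ?_ ?_
          · refine (measure_iUnion_fintype_le _ _).trans (Finset.sum_le_sum fun j _ => ?_)
            exact (measure_iUnion_fintype_le _ _).trans (Finset.sum_le_sum fun l _ => hA j l)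
          · refine (measure_iUnion_fintype_le _ _).trans (Finset.sum_le_sum fun i _ => ?_)
            exact (measure_iUnion_fintype_le _ _).trans (Finset.sum_le_sum fun j _ => hB i j)
      _ = ENNReal.ofReal (2 * (k : ℝ) ^ 2 * (1 / (n * ε ^ 2))) := by
          rw [ENNReal.ofReal_mul (by positivity), ← hc, show 2 * (k : ℝ) ^ 2 = ((2 * k ^ 2 : ℕ) : ℝ)
            by push_cast; rfl, ENNReal.ofReal_natCast]
          simp
          ring
      _ ≤ ENNReal.ofReal (2⁻¹) := by
          apply ENNReal.ofReal_le_ofReal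
          have : (0 : ℝ) < n * ε ^ 2 := by positivity
          rw [mul_one_div, div_le_iff₀ this]
          linarith
      _ = 2⁻¹ := by rw [ENNReal.ofReal_inv_of_pos two_pos]; simp
  have h1 : (1 : ENNReal) ≤ P (almostOrthogonal u ε) + 2⁻¹ := by
    calc (1 : ENNReal) = P Set.univ := measure_univ.symm
      _ ≤ _ := (measure_univ_le_add_compl (almostOrthogonal u ε)).trans (by gcongr)
  rw [← ENNReal.inv_two_add_inv_two] at h1
  exact (ENNReal.add_le_add_iff_right (by simp)).mp h1

/-- The volume of the almost orthogonal systems in a product of balls. -/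
theorem volume_pi_closedBall_le {k n : ℕ} {ρ : ℝ} (hρ : 0 < ρ) (hρ1 : ρ ≤ 1)
    {ε : ℝ} (hε : 0 < ε) (hn0 : 0 < n) (hn : 4 * (k : ℝ) ^ 2 ≤ n * ε ^ 2)
    (u : Fin k → EuclideanSpace ℝ (Fin n)) (hu : ∀ l, ‖u l‖ ≤ 1) :
    2⁻¹ * volume (Metric.closedBall (0 : EuclideanSpace ℝ (Fin n)) ρ) ^ k ≤
      volume (almostOrthogonal u ε ∩ Set.univ.pi fun _ => Metric.closedBall 0 ρ) := by
  set b := volume (Metric.closedBall (0 : EuclideanSpace ℝ (Fin n)) ρ) with hb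
  have hb0 : b ≠ 0 := volume_closedBall_pos n hρ
  have hbt : b ≠ ⊤ := volume_closedBall_ne_top n ρ
  have := isProbabilityMeasure_ballUniform n hρ
  have hP : Measure.pi (fun _ : Fin k => ballUniform n ρ) =
      (b ^ k)⁻¹ • (volume : Measure (Fin k → EuclideanSpace ℝ (Fin n))).restrict
        (Set.univ.pi fun _ => Metric.closedBall 0 ρ) := by
    refine Measure.pi_eq fun s hs => ?_
    rw [Measure.smul_apply, volume_pi, Measure.restrict_pi_pi, Measure.pi_pi]
    simp only [ballUniform, Measure.smul_apply, smul_eq_mul, Finset.prod_mul_distrib,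
      Finset.prod_const, Finset.card_univ, Fintype.card_fin, ENNReal.inv_pow, ← hb]
  have h := half_le_pi_ballUniform_almostOrthogonal hρ hρ1 hε hn0 hn u hu
  rw [hP, Measure.smul_apply, Measure.restrict_apply (isOpen_almostOrthogonal u ε).measurableSet,
    smul_eq_mul, mul_comm, ← div_eq_mul_inv,
    ENNReal.le_div_iff_mul_le (Or.inl (pow_ne_zero k hb0)) (Or.inl (ENNReal.pow_ne_top hbt))] at h
  exact h

/-! ### Neighbourhoods of frames and the Blichfeldt estimate -/

/-- Systems of vectors close to `t • u`. -/
def frameNhd {k n : ℕ} (t ρ ε : ℝ) (u : Fin k → EuclideanSpace ℝ (Fin n)) :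
    Set (Fin k → EuclideanSpace ℝ (Fin n)) :=
  (fun v => v - t • u) ⁻¹' (almostOrthogonal u ε ∩ Set.univ.pi fun _ => Metric.closedBall 0 ρ)

theorem measurableSet_frameNhd {k n : ℕ} (t ρ ε : ℝ) (u : Fin k → EuclideanSpace ℝ (Fin n)) :
    MeasurableSet (frameNhd t ρ ε u) := by
  refine ((isOpen_almostOrthogonal u ε).measurableSet.inter
    (isClosed_set_pi fun _ _ => Metric.isClosed_closedBall).measurableSet).preimage ?_
  exact measurable_id.sub_const _

theorem volume_frameNhd {k n : ℕ} (t ρ ε : ℝ) (u : Fin k → EuclideanSpace ℝ (Fin n)) :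
    volume (frameNhd t ρ ε u) =
      volume (almostOrthogonal u ε ∩ Set.univ.pi fun _ => Metric.closedBall 0 ρ) := by
  simp only [frameNhd, sub_eq_add_neg]
  exact measure_preimage_add_right _ _ _

/-- If each point of `D` lies in at most `N` of the subsets `S p`, then the sum of the measures
of these sets is at most `N` times the measure of `D`. -/
theorem sum_measure_le_of_card_le {α ι : Type*} [MeasurableSpace α] (μ : Measure α)
    (C : Finset ι) (S : ι → Set α) (hS : ∀ p, MeasurableSet (S p)) {D : Set α}
    (hD : MeasurableSet D) (hSD : ∀ p, S p ⊆ D) {N : ENNReal}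
    (hN : ∀ v, ∀ C' ⊆ C, (∀ p ∈ C', v ∈ S p) → (C'.card : ENNReal) ≤ N) :
    ∑ p ∈ C, μ (S p) ≤ N * μ D := by
  classical
  calc ∑ p ∈ C, μ (S p) = ∑ p ∈ C, ∫⁻ v, (S p).indicator 1 v ∂μ := by
        simp only [lintegral_indicator_one (hS _)]
    _ = ∫⁻ v, ∑ p ∈ C, (S p).indicator 1 v ∂μ :=
        (lintegral_finsetSum _ fun p _ => measurable_one.indicator (hS p)).symm
    _ ≤ ∫⁻ v, D.indicator (fun _ => N) v ∂μ := by
        refine lintegral_mono fun v => ?_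
        by_cases hv : v ∈ D
        · rw [Set.indicator_of_mem hv]
          refine le_trans (le_of_eq ?_) (hN v (C.filter fun p => v ∈ S p)
            (Finset.filter_subset _ _) fun p hp => (Finset.mem_filter.mp hp).2)
          simp [Set.indicator_apply]
        · rw [Set.indicator_of_notMem hv]
          refine (Finset.sum_eq_zero fun p _ => ?_).le
          rw [Set.indicator_of_notMem fun h => hv (hSD p h)]
    _ = N * μ D := lintegral_indicator_const hD N

/-- With `w = v - t • u` the cross term `2t⟨w j, u j⟩` is at most `2ε`, and the squares add up to at
most `ρ² + t² = 1`. -/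
theorem norm_le_of_mem_frameNhd {k n : ℕ} {t ρ ε : ℝ} (ht0 : 0 ≤ t) (ht1 : t ≤ 1)
    (hρ : ρ ^ 2 + t ^ 2 = 1) {u v : Fin k → EuclideanSpace ℝ (Fin n)} (hu : Orthonormal ℝ u)
    (hv : v ∈ frameNhd t ρ ε u) (j : Fin k) : ‖v j‖ ^ 2 ≤ 1 + 2 * ε := by
  obtain ⟨⟨h1, -⟩, h2⟩ := hv
  have h3 : ‖v j - t • u j‖ ≤ ρ := by simpa using h2 j (Set.mem_univ j)
  have h4 := pow_le_pow_left₀ (norm_nonneg _) h3 2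
  have h5 : |inner ℝ (v j - t • u j) (u j)| < ε := h1 j j
  have h6 : v j = (v j - t • u j) + t • u j := by abel
  have h7 := (abs_lt.mp h5).2
  have h8 := (abs_nonneg _).trans_lt h5
  rw [h6, norm_add_sq_real, inner_smul_right, norm_smul, hu.1, mul_one, Real.norm_eq_abs, sq_abs]
  nlinarith

theorem le_inner_of_mem_frameNhd {k n : ℕ} {t ρ ε : ℝ}
    {u v : Fin k → EuclideanSpace ℝ (Fin n)} (hu : Orthonormal ℝ u)
    (hv : v ∈ frameNhd t ρ ε u) (j : Fin k) : t - ε ≤ inner ℝ (u j) (v j) := by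
  have h5 : |inner ℝ (v j - t • u j) (u j)| < ε := hv.1.1 j j
  rw [inner_sub_left, inner_smul_left, real_inner_self_eq_norm_sq, hu.1, real_inner_comm] at h5
  have := (abs_lt.mp h5).1
  simp at this
  linarith

/-- Expanding `v = w + t • u`, the term `t²⟨u i, u j⟩` vanishes, and each of the other three is at
most `ε` in absolute value because `t ≤ 1`. -/
theorem abs_inner_le_of_mem_frameNhd {k n : ℕ} {t ρ ε : ℝ} (ht0 : 0 ≤ t) (ht1 : t ≤ 1)
    {u v : Fin k → EuclideanSpace ℝ (Fin n)} (hu : Orthonormal ℝ u)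
    (hv : v ∈ frameNhd t ρ ε u) {i j : Fin k} (hij : i ≠ j) : |inner ℝ (v i) (v j)| ≤ 3 * ε := by
  have h1 : |inner ℝ (v i - t • u i) (u j)| < ε := hv.1.1 i j
  have h2 : |inner ℝ (v j - t • u j) (u i)| < ε := hv.1.1 j i
  have h3 : |inner ℝ (v i - t • u i) (v j - t • u j)| < ε := hv.1.2 i j hij
  have h4 : inner ℝ (v i) (v j) = inner ℝ (v i - t • u i) (v j - t • u j)
      + t * inner ℝ (v i - t • u i) (u j) + t * inner ℝ (v j - t • u j) (u i) := by
    simp only [inner_sub_left, inner_sub_right, inner_smul_left, inner_smul_right, hu.2 hij,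
      hu.2 hij.symm, real_inner_comm (u i) (v j)]
    simp
  rw [h4]
  have h5 := abs_lt.mp h1
  have h6 := abs_lt.mp h2
  have h7 := abs_lt.mp h3
  rw [abs_le]
  constructor <;> nlinarith

/-- The Blichfeldt-type estimate of the size of a code. -/
theorem IsCode.card_le {k n : ℕ} {δ : ℝ} (hδ : 0 ≤ δ) (hδk : δ ^ 2 ≤ k) {C : Finset (Gr k n)}
    (hC : IsCode δ C) {t ρ ε A η : ℝ} (ht1 : t ≤ 1) (hρ0 : 0 < ρ)
    (hρ : ρ ^ 2 + t ^ 2 = 1) (hε : 0 < ε) (hεt : ε ≤ t) (hn0 : 0 < n)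
    (hn : 4 * (k : ℝ) ^ 2 ≤ n * ε ^ 2)
    (hA : A = k * (1 + 2 * ε) ^ 2 + k ^ 2 * (3 * ε) ^ 2)
    (hη : η = (k * (t - ε) ^ 2) ^ 2 - A * (k - δ ^ 2)) (hη0 : 0 < η) :
    (C.card : ℝ) ≤ 2 * (A * k / η) * (Real.sqrt (1 + 2 * ε) / ρ) ^ (n * k) := by
  have ht0 : 0 ≤ t := hε.le.trans hεt
  have hρ1 : ρ ≤ 1 := by nlinarith
  have hA0 : 0 ≤ A := by rw [hA]; positivity
  set R := Real.sqrt (1 + 2 * ε) with hR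
  have hR0 : 0 < R := Real.sqrt_pos.mpr (by linarith)
  set D : Set (Fin k → EuclideanSpace ℝ (Fin n)) := Set.univ.pi fun _ => Metric.closedBall 0 R
    with hD
  have hmult : ∀ v, ∀ C' ⊆ C, (∀ p ∈ C', v ∈ frameNhd t ρ ε p.frame) →
      (C'.card : ENNReal) ≤ ENNReal.ofReal (A * k / η) := by
    intro v C' hC' hv
    rw [← ENNReal.ofReal_natCast]
    apply ENNReal.ofReal_le_ofReal
    -- The estimate of the Gram sum of `v` needs one plane `p₀` whose neighbourhood contains `v`.
    rcases C'.eq_empty_or_nonempty with h0 | ⟨p₀, hp₀⟩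
    · rw [h0]; simpa using by positivity
    rw [le_div_iff₀ hη0, hη]
    have hcode : IsCode δ C' := Set.Pairwise.mono (Finset.coe_subset.mpr hC') hC
    refine hcode.card_mul_le hδ v (by positivity) (fun p hp => ?_) ?_ hδk
    · calc (k : ℝ) * (t - ε) ^ 2 = ∑ _j : Fin k, (t - ε) ^ 2 := by simp
        _ ≤ _ := Finset.sum_le_sum fun j _ => pow_le_pow_left₀ (by linarith)
            (le_inner_of_mem_frameNhd p.orthonormal_frame (hv p hp) j) 2
    · calc ∑ i, ∑ j, (inner ℝ (v i) (v j)) ^ 2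
          ≤ ∑ i : Fin k, ∑ j : Fin k, ((if i = j then (1 + 2 * ε) ^ 2 else 0) + (3 * ε) ^ 2) := by
            refine Finset.sum_le_sum fun i _ => Finset.sum_le_sum fun j _ => ?_
            split_ifs with hij
            · rw [← hij, real_inner_self_eq_norm_sq]
              have := pow_le_pow_left₀ (sq_nonneg _)
                (norm_le_of_mem_frameNhd ht0 ht1 hρ p₀.orthonormal_frame (hv p₀ hp₀) i) 2
              nlinarith [sq_nonneg (3 * ε)]
            · rw [zero_add, ← sq_abs]
              exact pow_le_pow_left₀ (abs_nonneg _)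
                (abs_inner_le_of_mem_frameNhd ht0 ht1 p₀.orthonormal_frame (hv p₀ hp₀) hij) 2
        _ = A := by
            rw [hA]
            simp [Finset.sum_add_distrib]
            ring
  have hsub : ∀ p : Gr k n, frameNhd t ρ ε p.frame ⊆ D := by
    intro p v hv j _
    rw [mem_closedBall_zero_iff]
    exact Real.le_sqrt_of_sq_le (norm_le_of_mem_frameNhd ht0 ht1 hρ p.orthonormal_frame hv j)
  have hDm : MeasurableSet D :=
    (isClosed_set_pi fun _ _ => Metric.isClosed_closedBall).measurableSet
  have hsum := sum_measure_le_of_card_le volume C (fun p => frameNhd t ρ ε p.frame)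
    (fun p => measurableSet_frameNhd _ _ _ _) hDm hsub hmult
  have hlow : (C.card : ENNReal) *
      (2⁻¹ * volume (Metric.closedBall (0 : EuclideanSpace ℝ (Fin n)) ρ) ^ k) ≤
      ∑ p ∈ C, volume (frameNhd t ρ ε p.frame) := by
    rw [← nsmul_eq_mul]
    refine Finset.card_nsmul_le_sum _ _ _ fun p _ => ?_
    rw [volume_frameNhd]
    exact volume_pi_closedBall_le hρ0 hρ1 hε hn0 hn _ fun l => (p.orthonormal_frame.1 l).le
  have hvD : volume D = volume (Metric.closedBall (0 : EuclideanSpace ℝ (Fin n)) R) ^ k := by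
    rw [hD, volume_pi, Measure.pi_pi]
    simp
  have hfin := hlow.trans hsum
  rw [hvD] at hfin
  have hreal := ENNReal.toReal_mono (by
    exact ENNReal.mul_ne_top ENNReal.ofReal_ne_top
      (ENNReal.pow_ne_top (volume_closedBall_ne_top n R))) hfin
  -- Scaling reduces both volumes to that of the unit ball, which then cancels and leaves the ratio
  -- of the radii to the power `n * k`.
  have hb : ∀ r : ℝ, 0 < r →
      (volume (Metric.closedBall (0 : EuclideanSpace ℝ (Fin n)) r)).toReal
        = r ^ n * (volume (Metric.closedBall (0 : EuclideanSpace ℝ (Fin n)) 1)).toReal := by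
    intro r hr
    rw [Measure.addHaar_closedBall' _ _ hr.le, ENNReal.toReal_mul,
      ENNReal.toReal_ofReal (by positivity)]
    simp
  have hv1 : 0 < (volume (Metric.closedBall (0 : EuclideanSpace ℝ (Fin n)) 1)).toReal :=
    ENNReal.toReal_pos (volume_closedBall_pos n one_pos) (volume_closedBall_ne_top n 1)
  simp only [ENNReal.toReal_mul, ENNReal.toReal_pow, hb ρ hρ0, hb R hR0, ENNReal.toReal_natCast,
    ENNReal.toReal_inv, ENNReal.toReal_ofNat, mul_pow] at hreal
  rw [ENNReal.toReal_ofReal (by positivity)] at hreal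
  have hv1k := pow_pos hv1 k
  rw [← pow_mul, ← pow_mul] at hreal
  have hρk : 0 < ρ ^ (n * k) := by positivity
  rw [div_pow, mul_div_assoc', le_div_iff₀ hρk]
  refine le_of_mul_le_mul_right ?_ hv1k
  linarith

/-! ### Comparison of the bounds and passage to the rate -/

theorem rankinBound_lt_hammingBound {k : ℕ} (hk : 1 ≤ k) {δ : ℝ} (hδ : 0 < δ)
    (hδk : δ ≤ Real.sqrt k) : rankinBound k δ < hammingBound k δ := by
  have hk0 : (0 : ℝ) < k := by exact_mod_cast hk
  have hδ2 : δ ^ 2 ≤ k := by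
    have := pow_le_pow_left₀ hδ.le hδk 2
    rwa [Real.sq_sqrt hk0.le] at this
  have h1 : δ ^ 2 / (2 * (k : ℝ)) < δ ^ 2 / k := by
    apply div_lt_div_of_pos_left (by positivity) hk0
    linarith
  have h2 : δ ^ 2 / k ≤ 1 := (div_le_one hk0).mpr hδ2
  have h3 : Real.sqrt (1 - δ ^ 2 / k) < Real.sqrt (1 - δ ^ 2 / (2 * (k : ℝ))) :=
    Real.sqrt_lt_sqrt (by linarith) (by linarith)
  have h4 : Real.sqrt (1 - δ ^ 2 / (2 * (k : ℝ))) < 1 := by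
    rw [Real.sqrt_lt' one_pos]
    have : 0 < δ ^ 2 / (2 * (k : ℝ)) := by positivity
    linarith
  have h5 : Real.log (Real.sqrt (1 - Real.sqrt (1 - δ ^ 2 / (2 * (k : ℝ)))))
      < Real.log (Real.sqrt (1 - Real.sqrt (1 - δ ^ 2 / (k : ℝ)))) :=
    Real.log_lt_log (Real.sqrt_pos.mpr (by linarith))
      (Real.sqrt_lt_sqrt (by linarith) (by linarith))
  rw [rankinBound, hammingBound]
  nlinarith

theorem log_maxCodeSize_le {k n : ℕ} {δ K : ℝ} (hK : 0 < K)
    (h : ∀ C : Finset (Gr k n), IsCode δ C → (C.card : ℝ) ≤ K) :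
    ENNReal.log (maxCodeSize k n δ : ENNReal) ≤ (Real.log K : EReal) := by
  -- The supremum is taken in `ℕ∞`, so the real bound `K` is first rounded down to a natural number.
  have h1 : maxCodeSize k n δ ≤ (⌊K⌋₊ : ℕ∞) := by
    refine iSup₂_le fun C hC => ?_
    exact_mod_cast Nat.le_floor (h C hC)
  have h2 : (maxCodeSize k n δ : ENNReal) ≤ ENNReal.ofReal K := by
    calc (maxCodeSize k n δ : ENNReal) ≤ (((⌊K⌋₊ : ℕ) : ℕ∞) : ENNReal) := by exact_mod_cast h1
      _ = ENNReal.ofReal (⌊K⌋₊ : ℝ) := by simp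
      _ ≤ _ := ENNReal.ofReal_le_ofReal (Nat.floor_le hK.le)
  rw [← ENNReal.log_ofReal_of_pos hK]
  exact ENNReal.log_monotone h2

/-- Exponential bounds of the sizes of codes bound the rate. -/
theorem rate_le_of_card_le {k : ℕ} {δ N r b : ℝ} (hN : 0 < N) (hr : 0 < r)
    (hb : k * Real.log r < b)
    (h : ∀ᶠ n : ℕ in atTop, ∀ C : Finset (Gr k n), IsCode δ C → (C.card : ℝ) ≤ N * r ^ (n * k)) :
    rate k δ ≤ (b : EReal) := by
  have hlim : Tendsto (fun n : ℕ => Real.log N / n + k * Real.log r) atTop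
      (𝓝 (0 + k * Real.log r)) :=
    (tendsto_const_div_atTop_nhds_zero_nat _).add tendsto_const_nhds
  rw [zero_add] at hlim
  refine limsup_le_of_le (by isBoundedDefault) ?_
  filter_upwards [h, hlim.eventually_lt_const hb, eventually_gt_atTop 0] with n hn hnb hn0
  have hn0' : (0 : ℝ) < n := by exact_mod_cast hn0
  calc ENNReal.log (maxCodeSize k n δ : ENNReal) / (n : EReal)
      ≤ (Real.log (N * r ^ (n * k)) : EReal) / (n : EReal) :=
        EReal.div_le_div_right_of_nonneg (by positivity)
          (log_maxCodeSize_le (by positivity) hn)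
    _ = ((Real.log (N * r ^ (n * k)) / n : ℝ) : EReal) := by
        rw [EReal.coe_div]
        rfl
    _ ≤ b := by
        rw [EReal.coe_le_coe_iff]
        refine le_trans (le_of_eq ?_) hnb.le
        rw [Real.log_mul hN.ne' (by positivity), Real.log_pow]
        push_cast
        field_simp

theorem rate_le_rankinBound {k : ℕ} (hk : 1 ≤ k) {δ : ℝ} (hδ : 0 < δ)
    (hδk : δ ≤ Real.sqrt k) : rate k δ ≤ (rankinBound k δ : EReal) := by
  have hk0 : (0 : ℝ) < k := by exact_mod_cast hk
  have hδ2 : δ ^ 2 ≤ k := by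
    have := pow_le_pow_left₀ hδ.le hδk 2
    rwa [Real.sq_sqrt hk0.le] at this
  have hq : δ ^ 2 / k ≤ 1 := (div_le_one hk0).mpr hδ2
  have hq0 : 0 < δ ^ 2 / k := by positivity
  set s := Real.sqrt (1 - δ ^ 2 / k) with hs
  have hs0 : 0 ≤ s := Real.sqrt_nonneg _
  have hs2 : s ^ 2 = 1 - δ ^ 2 / k := Real.sq_sqrt (by linarith)
  have hs1 : s < 1 := by
    rw [hs, Real.sqrt_lt' one_pos]
    linarith
  have hsk : (k : ℝ) - δ ^ 2 = k * s ^ 2 := by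
    rw [hs2]
    field_simp
  -- It suffices to bound the rate by every real `b` above the Rankin bound, which leaves room for
  -- `t` and `ε`.
  rw [← EReal.le_of_forall_lt_iff_le]
  intro b hb
  rw [EReal.coe_lt_coe_iff, rankinBound, ← hs] at hb
  -- At `t = √s` the exponent is exactly the Rankin bound, but the multiplicity bound degenerates;
  -- `t` is taken slightly larger.
  obtain ⟨t, ⟨htb, ht1⟩, hts⟩ : ∃ t : ℝ, (-(k : ℝ) * Real.log (Real.sqrt (1 - t ^ 2)) < b ∧ t < 1) ∧
      Real.sqrt s < t := by
    have hc : ContinuousAt (fun t : ℝ => -(k : ℝ) * Real.log (Real.sqrt (1 - t ^ 2)))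
        (Real.sqrt s) := by
      refine continuousAt_const.mul (ContinuousAt.log (by fun_prop) ?_)
      rw [Real.sq_sqrt hs0]
      exact (Real.sqrt_pos.mpr (by linarith)).ne'
    have h1 : ∀ᶠ t in 𝓝 (Real.sqrt s), -(k : ℝ) * Real.log (Real.sqrt (1 - t ^ 2)) < b :=
      hc.eventually_lt_const (by simpa only [Real.sq_sqrt hs0] using hb)
    have h2 : ∀ᶠ t in 𝓝 (Real.sqrt s), t < 1 :=
      eventually_lt_nhds (by rwa [Real.sqrt_lt' one_pos, one_pow])
    have h3 : ∀ᶠ t in 𝓝[>] (Real.sqrt s), Real.sqrt s < t := self_mem_nhdsWithin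
    exact (((h1.and h2).filter_mono nhdsWithin_le_nhds).and h3).exists
  have ht0 : 0 < t := (Real.sqrt_nonneg s).trans_lt hts
  have hst : s < t ^ 2 := (Real.sqrt_lt' ht0).mp hts
  set ρ := Real.sqrt (1 - t ^ 2) with hρ
  have ht2 : 0 < 1 - t ^ 2 := by nlinarith
  have hρ0 : 0 < ρ := Real.sqrt_pos.mpr ht2
  have hρt : ρ ^ 2 + t ^ 2 = 1 := by
    rw [hρ, Real.sq_sqrt ht2.le]
    ring
  -- At `ε = 0` the first quantity is `k² (t⁴ - s²) > 0` and the exponent is `-k ln ρ < b`; both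
  -- strict inequalities persist for small `ε > 0`.
  obtain ⟨ε, ⟨⟨hη, hεb⟩, hεt⟩, hε⟩ : ∃ ε : ℝ,
      ((0 < (k * (t - ε) ^ 2) ^ 2 - (k * (1 + 2 * ε) ^ 2 + k ^ 2 * (3 * ε) ^ 2) * (k - δ ^ 2) ∧
      k * Real.log (Real.sqrt (1 + 2 * ε) / ρ) < b) ∧ ε < t) ∧ 0 < ε := by
    have h1 : ∀ᶠ ε in 𝓝 (0 : ℝ), 0 < (k * (t - ε) ^ 2) ^ 2 -
        (k * (1 + 2 * ε) ^ 2 + k ^ 2 * (3 * ε) ^ 2) * (k - δ ^ 2) := by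
      have hc : ContinuousAt (fun ε : ℝ => (k * (t - ε) ^ 2) ^ 2 -
        (k * (1 + 2 * ε) ^ 2 + k ^ 2 * (3 * ε) ^ 2) * (k - δ ^ 2)) 0 := by fun_prop
      refine hc.eventually_const_lt ?_
      have : s ^ 2 < (t ^ 2) ^ 2 := pow_lt_pow_left₀ hst hs0 two_ne_zero
      rw [hsk]
      have h4 : 0 < (k : ℝ) ^ 2 * ((t ^ 2) ^ 2 - s ^ 2) := mul_pos (by positivity) (by linarith)
      ring_nf at h4 ⊢
      linarith
    have h2 : ∀ᶠ ε in 𝓝 (0 : ℝ), k * Real.log (Real.sqrt (1 + 2 * ε) / ρ) < b := by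
      have hc : ContinuousAt (fun ε : ℝ => k * Real.log (Real.sqrt (1 + 2 * ε) / ρ)) 0 := by
        refine continuousAt_const.mul (ContinuousAt.log (by fun_prop) ?_)
        simp [hρ0.ne']
      refine hc.eventually_lt_const ?_
      beta_reduce
      rw [mul_zero, add_zero, Real.sqrt_one, one_div, Real.log_inv]
      linarith
    have h3 : ∀ᶠ ε in 𝓝 (0 : ℝ), ε < t := eventually_lt_nhds ht0
    have h4 : ∀ᶠ ε in 𝓝[>] (0 : ℝ), 0 < ε := self_mem_nhdsWithin
    exact ((((h1.and h2).and h3).filter_mono nhdsWithin_le_nhds).and h4).exists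
  refine rate_le_of_card_le (r := Real.sqrt (1 + 2 * ε) / ρ)
    (N := 2 * ((k * (1 + 2 * ε) ^ 2 + k ^ 2 * (3 * ε) ^ 2) * k /
      ((k * (t - ε) ^ 2) ^ 2 - (k * (1 + 2 * ε) ^ 2 + k ^ 2 * (3 * ε) ^ 2) * (k - δ ^ 2))))
    (mul_pos two_pos (div_pos (by positivity) hη)) (by positivity) hεb ?_
  have hlarge : ∀ᶠ n : ℕ in atTop, 4 * (k : ℝ) ^ 2 / ε ^ 2 ≤ n :=
    tendsto_natCast_atTop_atTop.eventually_ge_atTop _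
  filter_upwards [hlarge, eventually_gt_atTop 0] with n hn hn0 C hC
  rw [div_le_iff₀ (by positivity)] at hn
  exact hC.card_le hδ.le hδ2 ht1.le hρ0 hρt hε hεt.le hn0 hn rfl rfl hη

end

theorem theorem1 (k : ℕ) (hk : 1 ≤ k) (δ : ℝ) (hδ : 0 < δ) (hδk : δ ≤ Real.sqrt k) :
    rate k δ ≤ (rankinBound k δ : EReal) ∧ rankinBound k δ < hammingBound k δ :=
  ⟨rate_le_rankinBound hk hδ hδk, rankinBound_lt_hammingBound hk hδ hδk⟩
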